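/- Let $(a)_k=a(a+1)\cdots(a+k-1)$ denote the rising factorial. Then both series below converge absolutely and $$\left(\sum_{k=0}^{\infty}\frac{(\frac12)_k^2}{(1)_k^2}(3-2\sqrt2)^{2k}\right)\left(\sum_{k=0}^{\infty}\frac{(\frac12)_k^2}{(1)_k^2}(3-2\sqrt2)^{2k}\bigl[16(3\sqrt2-4)k+4(5\sqrt2-7)\bigr]\right)=\frac1\pi .$$ Put $d_0=3-2\sqrt2$, $b_0=16(3\sqrt2-4)$, $a_0=4(5\sqrt2-7)$, $c_0=b_0/(1-d_0^2)$, $r_0=a_0+\tfrac12c_0d_0^2$, $s_0=\sqrt{d_0}$, $t_0=r_0$. Then $d_0=s_0^2$, $b_0=48\sqrt2-64$, $a_0=20\sqrt2-28$, $c_0=4$ and $r_0=t_0=6-4\sqrt2$. Moreover, these initial values make each of the following iterations tend to $1/\pi$. Let $d_{n+1}=\dfrac{1-\sqrt{1-d_n^2}}{1+\sqrt{1-d_n^2}}$ for $n\ge0$. 1. Quadratic iteration: if $b_{n+1}=2b_n\dfrac{(1+d_{n+1})^3}{1-d_{n+1}}$ and $a_{n+1}=a_n(1+d_{n+1})^2+\dfrac{b_{n+1}d_{n+1}}{2(1+d_{n+1})}$,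 then $a_n\to1/\pi$. 2. Simplified quadratic iteration: if (with the same $a_0$) $a_{n+1}=a_n(1+d_{n+1})^2+c_0\,2^n d_{n+1}(1-d_{n+1})$, then $a_n\to1/\pi$. 3. Borweins' quadratic iteration: if $r_{n+1}=r_n(1+d_{n+1})^2-c_0\,2^n d_{n+1}$, then $r_n\to1/\pi$. 4. Borweins' quartic iteration: if $s_{n+1}=\dfrac{1-\sqrt[4]{1-s_n^4}}{1+\sqrt[4]{1-s_n^4}}$ and $t_{n+1}=(1+s_{n+1})^4t_n-c_0\,2^{2n+1}s_{n+1}(1+s_{n+1}+s_{n+1}^2)$, then $t_n\to1/\pi$. -/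

import Mathlib

/-- The coefficient `(1/2)_k² / (1)_k²`, with `(a)_k = a (a + 1) ⋯ (a + k - 1)` the rising
factorial. -/
noncomputable def hypCoeff (k : ℕ) : ℝ :=
  (ascPochhammer ℝ k).eval (1 / 2) ^ 2 / (ascPochhammer ℝ k).eval 1 ^ 2

/-- The iteration `d (n+1) = (1 - √(1 - d n ^ 2)) / (1 + √(1 - d n ^ 2))`. -/
noncomputable def dSeq (d₀ : ℝ) : ℕ → ℝ
  | 0 => d₀
  | n + 1 => (1 - √(1 - dSeq d₀ n ^ 2)) / (1 + √(1 - dSeq d₀ n ^ 2))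

/-- Quadratic algorithm, the sequence `b`. -/
noncomputable def bSeq (d₀ b₀ : ℝ) : ℕ → ℝ
  | 0 => b₀
  | n + 1 => 2 * bSeq d₀ b₀ n * ((1 + dSeq d₀ (n + 1)) ^ 3 / (1 - dSeq d₀ (n + 1)))

/-- Quadratic algorithm, the sequence `a`. -/
noncomputable def aSeq (d₀ b₀ a₀ : ℝ) : ℕ → ℝ
  | 0 => a₀
  | n + 1 => aSeq d₀ b₀ a₀ n * (1 + dSeq d₀ (n + 1)) ^ 2
      + bSeq d₀ b₀ (n + 1) * dSeq d₀ (n + 1) / (2 * (1 + dSeq d₀ (n + 1)))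

/-- Simplified quadratic algorithm, the sequence `a`, in terms of the constant `c₀`. -/
noncomputable def aSimpleSeq (d₀ a₀ c₀ : ℝ) : ℕ → ℝ
  | 0 => a₀
  | n + 1 => aSimpleSeq d₀ a₀ c₀ n * (1 + dSeq d₀ (n + 1)) ^ 2
      + c₀ * 2 ^ n * dSeq d₀ (n + 1) * (1 - dSeq d₀ (n + 1))

/-- Borweins' quadratic algorithm, the sequence `r`. -/
noncomputable def rSeq (d₀ r₀ c₀ : ℝ) : ℕ → ℝ
  | 0 => r₀
  | n + 1 => rSeq d₀ r₀ c₀ n * (1 + dSeq d₀ (n + 1)) ^ 2 - c₀ * 2 ^ n * dSeq d₀ (n + 1)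

/-- Borweins' quartic algorithm, the sequence `s`. -/
noncomputable def sSeq (s₀ : ℝ) : ℕ → ℝ
  | 0 => s₀
  | n + 1 => (1 - (1 - sSeq s₀ n ^ 4) ^ (1 / 4 : ℝ)) / (1 + (1 - sSeq s₀ n ^ 4) ^ (1 / 4 : ℝ))

/-- Borweins' quartic algorithm, the sequence `t`. -/
noncomputable def tSeq (s₀ t₀ c₀ : ℝ) : ℕ → ℝ
  | 0 => t₀
  | n + 1 => (1 + sSeq s₀ (n + 1)) ^ 4 * tSeq s₀ t₀ c₀ n
      - c₀ * 2 ^ (2 * n + 1) * sSeq s₀ (n + 1) * (1 + sSeq s₀ (n + 1) + sSeq s₀ (n + 1) ^ 2)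

/-!
Write `F(x) = ∑ hypCoeff k * x ^ k = ₂F₁(1/2, 1/2; 1; x)`, so that `F(k²) = 2 K(k) / π`. All the
claims come from one quantity, `hypInvariant a b x = F(x) (a F(x) + b x F'(x))`.

Landen's transformation `F(4 t / (1 + t)²) = (1 + t) F(t²)` (`hypF_landen`) and its derivative
(`hypQ_landen`) show that passing from `(a n, b n, d n ^ 2)` to the next triple of the quadratic
iteration does not change `hypInvariant` (`hypInvariant_landen`). Since `d n → 0` quadratically,
while `b n` grows only like `2 ^ n`, the terms `F(d n ^ 2) → 1` and `b n * d n ^ 2 → 0` drop out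
and `a n` tends to the value of the invariant at the start (`tendsto_aSeq`). The other iterations
are algebraic reformulations: `aSimpleSeq` uses `b n = c₀ 2 ^ n (1 - d n ^ 2)`, `rSeq` differs
from it by `c₀ 2 ^ n d n ^ 2 / 2 → 0`, and the quartic iteration performs two quadratic steps at
once, with `s n ^ 2 = d (2 n)`.

It remains to compute the invariant at `d₀ = 3 - 2 √2`, which is also the series identity. One
Landen step leads back to the modulus `1 / √2`, that is `x = 1 / 2`, with `a = 0` and `b = 1`.
There the value `1 / π` is Legendre's relation: the Wronskian
`x (1 - x) (F'(x) F(1 - x) + F(x) F'(1 - x))` is constant (`hypF_legendre`), and its limit at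
`x → 1⁻` is that of `(1 - x) F'(x)`. The function `(1 - x) F'(x)`, called `hypQ` below, has a
power series whose partial sums at `1` are `n * hypCoeff n`, so its limit is `1 / π` by Abel's
theorem and Wallis' product.

Landen's transformation too is a Wronskian argument: both sides satisfy the same second order
equation, singular at `t = 0`, and are regular with value `1` there.
-/

open Filter Topology Set

/-! ### Power series with bounded coefficients -/

theorem summable_mul_pow_of_abs_le_one {c : ℕ → ℝ} (hc : ∀ k, |c k| ≤ 1) {x : ℝ} (hx : |x| < 1) :
    Summable fun k => c k * x ^ k := by
  refine Summable.of_norm_bounded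
    (summable_geometric_of_abs_lt_one (r := |x|) (by simpa)) fun k => ?_
  rw [norm_mul, norm_pow, Real.norm_eq_abs, Real.norm_eq_abs]
  exact mul_le_of_le_one_left (by positivity) (hc k)

theorem summable_natCast_mul_pow_of_abs_le_one {c : ℕ → ℝ} (hc : ∀ k, |c k| ≤ 1) {x : ℝ}
    (hx : |x| < 1) : Summable fun k : ℕ => k * c k * x ^ k := by
  refine Summable.of_norm_bounded
    (summable_pow_mul_geometric_of_norm_lt_one (R := ℝ) 1 (r := |x|) (by simpa)) fun k => ?_
  rw [norm_mul, norm_mul, norm_pow, Real.norm_eq_abs, Real.norm_eq_abs, Real.norm_eq_abs, pow_one,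
    Nat.abs_cast]
  gcongr
  exact mul_le_of_le_one_right (by positivity) (hc k)

theorem summable_succ_mul_pow_of_abs_le_one {c : ℕ → ℝ} (hc : ∀ k, |c k| ≤ 1) {x : ℝ}
    (hx : |x| < 1) : Summable fun k : ℕ => (k + 1 : ℝ) * c (k + 1) * x ^ k := by
  have h1 := summable_natCast_mul_pow_of_abs_le_one (fun k => hc (k + 1)) hx
  have h2 := summable_mul_pow_of_abs_le_one (fun k => hc (k + 1)) hx
  refine (h1.add h2).congr fun k => ?_
  ring

theorem hasDerivAt_tsum_mul_pow {c : ℕ → ℝ} (hc : ∀ k, |c k| ≤ 1) {x : ℝ} (hx : |x| < 1) :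
    HasDerivAt (fun y => ∑' k, c k * y ^ k) (∑' k : ℕ, (k + 1 : ℝ) * c (k + 1) * x ^ k) x := by
  obtain ⟨r, hxr, hr1⟩ := exists_between hx
  have hr0 : 0 ≤ r := (abs_nonneg x).trans hxr.le
  have hra : |r| < 1 := by rwa [abs_of_nonneg hr0]
  have hone : Summable fun k : ℕ => (k : ℝ) * r ^ (k - 1) := by
    rw [← summable_nat_add_iff 1]
    simpa using summable_succ_mul_pow_of_abs_le_one (c := fun _ => 1) (by simp) hra
  have key : HasDerivAt (fun y => ∑' k, c k * y ^ k) (∑' k : ℕ, c k * (k * x ^ (k - 1))) x := by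
    refine hasDerivAt_tsum_of_isPreconnected hone isOpen_Ioo (isPreconnected_Ioo (a := -r) (b := r))
      (fun k y _ => (hasDerivAt_pow k y).const_mul (c k)) (fun k y hy => ?_) (abs_lt.1 hxr)
      (summable_mul_pow_of_abs_le_one hc hx) (abs_lt.1 hxr)
    have hy' : |y| ≤ r := (abs_lt.2 hy).le
    rw [norm_mul, norm_mul, norm_pow, Real.norm_eq_abs, Real.norm_eq_abs, Real.norm_eq_abs,
      Nat.abs_cast]
    calc |c k| * (k * |y| ^ (k - 1)) ≤ 1 * (k * r ^ (k - 1)) := by gcongr; exact hc k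
      _ = _ := one_mul _
  convert key using 1
  have hs : Summable fun k : ℕ => c k * (k * x ^ (k - 1)) := by
    rw [← summable_nat_add_iff 1]
    refine (summable_succ_mul_pow_of_abs_le_one hc hx).congr fun k => ?_
    push_cast [Nat.add_sub_cancel]
    ring
  rw [hs.tsum_eq_zero_add]
  simp only [Nat.cast_zero, zero_mul, mul_zero, zero_add, Nat.add_sub_cancel]
  refine tsum_congr fun k => ?_
  push_cast
  ring

theorem mul_tsum_succ_mul_pow {c : ℕ → ℝ} (hc : ∀ k, |c k| ≤ 1) {x : ℝ} (hx : |x| < 1) :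
    x * ∑' k : ℕ, (k + 1 : ℝ) * c (k + 1) * x ^ k = ∑' k : ℕ, k * c k * x ^ k := by
  rw [(summable_natCast_mul_pow_of_abs_le_one hc hx).tsum_eq_zero_add, ← tsum_mul_left]
  simp only [Nat.cast_zero, zero_mul, zero_add]
  refine tsum_congr fun k => ?_
  push_cast
  ring

/-- Multiplying a power series by `1 - x` replaces its coefficients by their differences. -/
theorem one_sub_mul_tsum_mul_pow {c d : ℕ → ℝ} (h0 : d 0 = c 0)
    (hsucc : ∀ k, d (k + 1) = c (k + 1) - c k) {x : ℝ} (hc : Summable fun k => c k * x ^ k) :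
    (1 - x) * ∑' k, c k * x ^ k = ∑' k, d k * x ^ k := by
  have hc1 := (summable_nat_add_iff 1).2 hc
  have hcx := hc.mul_left x
  have hd1 : ∀ k, d (k + 1) * x ^ (k + 1) = c (k + 1) * x ^ (k + 1) - x * (c k * x ^ k) := by
    intro k
    rw [hsucc]
    ring
  have hd : Summable fun k => d k * x ^ k := by
    rw [← summable_nat_add_iff 1]
    exact (hc1.sub hcx).congr fun k => (hd1 k).symm
  rw [hd.tsum_eq_zero_add, tsum_congr hd1, hc1.tsum_sub hcx, tsum_mul_left, sub_mul, one_mul,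
    h0, hc.tsum_eq_zero_add]
  ring

/-- If `c k → l` then `(1 - x) ∑ c k x ^ k → l` as `x → 1⁻`: Abel's limit theorem for the series of
differences of `c`. -/
theorem tendsto_one_sub_mul_tsum_mul_pow {c : ℕ → ℝ} {l : ℝ} (hc : ∀ k, |c k| ≤ 1)
    (hl : Tendsto c atTop (𝓝 l)) :
    Tendsto (fun x => (1 - x) * ∑' k, c k * x ^ k) (𝓝[<] 1) (𝓝 l) := by
  obtain ⟨d, hd0, hds⟩ : ∃ d : ℕ → ℝ, d 0 = c 0 ∧ ∀ k, d (k + 1) = c (k + 1) - c k :=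
    ⟨fun k => Nat.casesOn k (c 0) fun j => c (j + 1) - c j, rfl, fun _ => rfl⟩
  have hsum : ∀ n, ∑ i ∈ Finset.range (n + 1), d i = c n := by
    intro n
    rw [Finset.sum_range_succ', hd0, Finset.sum_congr rfl fun k _ => hds k, Finset.sum_range_sub]
    ring
  have hd : Tendsto (fun n => ∑ i ∈ Finset.range n, d i) atTop (𝓝 l) := by
    rw [← tendsto_add_atTop_iff_nat 1]
    simpa only [hsum] using hl
  refine (Real.tendsto_tsum_powerSeries_nhdsWithin_lt hd).congr' ?_
  filter_upwards [Ioo_mem_nhdsLT (show (0 : ℝ) < 1 by norm_num)] with x hx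
  exact (one_sub_mul_tsum_mul_pow hd0 hds
    (summable_mul_pow_of_abs_le_one hc (abs_lt.2 ⟨by linarith [hx.1], hx.2⟩))).symm

/-! ### The hypergeometric coefficients -/

@[simp] theorem hypCoeff_zero : hypCoeff 0 = 1 := by simp [hypCoeff]

theorem hypCoeff_succ (k : ℕ) :
    hypCoeff (k + 1) = hypCoeff k * ((k + 1 / 2) / (k + 1)) ^ 2 := by
  rw [hypCoeff, hypCoeff, ascPochhammer_succ_eval, ascPochhammer_succ_eval, mul_pow, mul_pow,
    mul_div_mul_comm, div_pow, add_comm (1 / 2 : ℝ), add_comm (1 : ℝ)]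

theorem hypCoeff_pos (k : ℕ) : 0 < hypCoeff k := by
  induction k with
  | zero => simp
  | succ k ih =>
    rw [hypCoeff_succ]
    positivity

theorem hypCoeff_le_one (k : ℕ) : hypCoeff k ≤ 1 := by
  induction k with
  | zero => simp
  | succ k ih =>
    rw [hypCoeff_succ]
    refine mul_le_one₀ ih (by positivity) (pow_le_one₀ (by positivity) ?_)
    rw [div_le_one (by positivity)]
    linarith

theorem abs_hypCoeff_le_one (k : ℕ) : |hypCoeff k| ≤ 1 := by
  rw [abs_of_pos (hypCoeff_pos k)]
  exact hypCoeff_le_one k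

theorem hypCoeff_eq_wallis (k : ℕ) : hypCoeff k = ((2 * k + 1) * Real.Wallis.W k)⁻¹ := by
  induction k with
  | zero => simp [Real.Wallis.W]
  | succ k ih =>
    have := (Real.Wallis.W_pos k).ne'
    rw [hypCoeff_succ, ih, Real.Wallis.W_succ]
    push_cast
    field_simp
    ring

/-- Wallis' product for `π`. -/
theorem tendsto_natCast_mul_hypCoeff :
    Tendsto (fun k : ℕ => k * hypCoeff k) atTop (𝓝 (1 / Real.pi)) := by
  have h1 : Tendsto (fun k : ℕ => (k : ℝ) / (2 * k + 1)) atTop (𝓝 (1 / 2)) := by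
    have h : Tendsto (fun k : ℕ => 1 / 2 - 1 / (2 * (2 * (k : ℝ) + 1))) atTop (𝓝 (1 / 2 - 0)) := by
      refine Tendsto.const_sub _ (tendsto_const_nhds.div_atTop ?_)
      exact (tendsto_atTop_add_const_right _ _
        (tendsto_natCast_atTop_atTop.const_mul_atTop two_pos)).const_mul_atTop two_pos
    rw [sub_zero] at h
    refine h.congr fun k => ?_
    field_simp
    ring
  have h2 := h1.div Real.Wallis.tendsto_W_nhds_pi_div_two Real.pi_div_two_pos.ne'
  rw [show (1 / 2 : ℝ) / (Real.pi / 2) = 1 / Real.pi by field_simp] at h2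
  refine h2.congr fun k => ?_
  simp only [Pi.div_apply]
  rw [hypCoeff_eq_wallis, mul_inv, div_div, div_eq_mul_inv, mul_inv]

theorem tendsto_hypCoeff : Tendsto hypCoeff atTop (𝓝 0) := by
  have h := tendsto_natCast_mul_hypCoeff.div_atTop (tendsto_natCast_atTop_atTop (R := ℝ))
  refine h.congr' ?_
  filter_upwards [eventually_ge_atTop 1] with k hk
  have : (k : ℝ) ≠ 0 := by positivity
  field_simp

/-! ### The hypergeometric function and its differential equation -/

/-- The hypergeometric function `₂F₁(1/2, 1/2; 1; x)`, that is `2 K(k) / π` for `x = k ^ 2`. -/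
noncomputable def hypF (x : ℝ) : ℝ := ∑' k, hypCoeff k * x ^ k

/-- The function `(1 - x) F'(x)` for `F = hypF`, given by its own power series. It is bounded on
`(0, 1)`, in contrast to `F'`. -/
noncomputable def hypQ (x : ℝ) : ℝ := ∑' k : ℕ, hypCoeff k / (4 * (k + 1)) * x ^ k

/-- The coefficients of `hypQ` telescope. In another form, this is the recursion for `hypCoeff`, so
it encodes the hypergeometric equation. -/
theorem hypCoeff_div_eq_sub (k : ℕ) :
    hypCoeff k / (4 * (k + 1)) = (k + 1 : ℕ) * hypCoeff (k + 1) - k * hypCoeff k := by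
  rw [hypCoeff_succ]
  push_cast
  field_simp
  ring

theorem abs_hypCoeff_div_le_one (k : ℕ) : |hypCoeff k / (4 * (k + 1))| ≤ 1 := by
  have := hypCoeff_pos k
  rw [abs_of_pos (by positivity), div_le_one (by positivity)]
  linarith [hypCoeff_le_one k, Nat.cast_nonneg (α := ℝ) k]

theorem one_sub_mul_deriv_hypF {x : ℝ} (hx : |x| < 1) :
    (1 - x) * ∑' k : ℕ, (k + 1 : ℝ) * hypCoeff (k + 1) * x ^ k = hypQ x := by
  refine one_sub_mul_tsum_mul_pow ?_ (fun k => ?_)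
    (summable_succ_mul_pow_of_abs_le_one abs_hypCoeff_le_one hx)
  · rw [hypCoeff_div_eq_sub]; simp
  · rw [hypCoeff_div_eq_sub]; push_cast; ring

theorem hasDerivAt_hypF {x : ℝ} (hx : |x| < 1) : HasDerivAt hypF (hypQ x / (1 - x)) x := by
  have h1 : 1 - x ≠ 0 := by linarith [(abs_lt.1 hx).2]
  rw [← one_sub_mul_deriv_hypF hx, mul_div_cancel_left₀ _ h1]
  exact hasDerivAt_tsum_mul_pow abs_hypCoeff_le_one hx

/-- The hypergeometric equation in the form `(x (1 - x) F'(x))' = F(x) / 4`. -/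
theorem hasDerivAt_mul_hypQ {x : ℝ} (hx : |x| < 1) :
    HasDerivAt (fun y => y * hypQ y) (hypF x / 4) x := by
  have hq := abs_hypCoeff_div_le_one
  refine ((hasDerivAt_id' x).mul (hasDerivAt_tsum_mul_pow hq hx)).congr_deriv ?_
  rw [one_mul, mul_tsum_succ_mul_pow hq hx, ← (summable_mul_pow_of_abs_le_one hq hx).tsum_add
    (summable_natCast_mul_pow_of_abs_le_one hq hx), hypF, ← tsum_div_const]
  refine tsum_congr fun k => ?_
  field_simp
  ring

theorem continuousAt_hypF {x : ℝ} (hx : |x| < 1) : ContinuousAt hypF x :=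
  (hasDerivAt_hypF hx).continuousAt

theorem continuousAt_hypQ {x : ℝ} (hx : |x| < 1) : ContinuousAt hypQ x :=
  (hasDerivAt_tsum_mul_pow abs_hypCoeff_div_le_one hx).continuousAt

theorem hypF_zero : hypF 0 = 1 := by
  rw [hypF, tsum_eq_single 0 fun k hk => by simp [hk]]
  simp

theorem hypF_pos {x : ℝ} (h0 : 0 ≤ x) (h1 : x < 1) : 0 < hypF x :=
  (summable_mul_pow_of_abs_le_one abs_hypCoeff_le_one (abs_lt.2 ⟨by linarith, h1⟩)).tsum_pos
    (fun k => mul_nonneg (hypCoeff_pos k).le (by positivity)) 0 (by simp)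

/-- The function `x F'(x)` in terms of `hypQ`. -/
theorem tsum_natCast_mul_hypCoeff_mul_pow {x : ℝ} (hx : |x| < 1) :
    ∑' k : ℕ, k * hypCoeff k * x ^ k = x * hypQ x / (1 - x) := by
  have h1 : 1 - x ≠ 0 := by linarith [(abs_lt.1 hx).2]
  rw [← mul_tsum_succ_mul_pow abs_hypCoeff_le_one hx, ← one_sub_mul_deriv_hypF hx]
  field_simp

/-! ### The Legendre relation -/

theorem tendsto_hypQ_one : Tendsto hypQ (𝓝[<] 1) (𝓝 (1 / Real.pi)) := by
  refine Real.tendsto_tsum_powerSeries_nhdsWithin_lt ?_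
  refine tendsto_natCast_mul_hypCoeff.congr fun n => ?_
  simp only [hypCoeff_div_eq_sub]
  rw [Finset.sum_range_sub fun k : ℕ => (k : ℝ) * hypCoeff k]
  simp

/-- The Wronskian of the solutions `F(x)` and `F(1 - x)` of the hypergeometric equation. This is
Legendre's relation between complete elliptic integrals; the constant is read off at `x → 1⁻`. -/
theorem hypF_legendre {x : ℝ} (h0 : 0 < x) (h1 : x < 1) :
    x * hypQ x * hypF (1 - x) + hypF x * ((1 - x) * hypQ (1 - x)) = 1 / Real.pi := by
  set w : ℝ → ℝ := fun x => x * hypQ x * hypF (1 - x) + hypF x * ((1 - x) * hypQ (1 - x)) with hw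
  have hder : ∀ y ∈ Ioo (0 : ℝ) 1, HasDerivAt w 0 y := by
    intro y hy
    have hy1 : |y| < 1 := abs_lt.2 ⟨by linarith [hy.1], hy.2⟩
    have hy2 : |1 - y| < 1 := abs_lt.2 ⟨by linarith [hy.2], by linarith [hy.1]⟩
    have hsub : HasDerivAt (fun y : ℝ => 1 - y) (-1) y := (hasDerivAt_id y).const_sub 1
    refine (((hasDerivAt_mul_hypQ hy1).mul ((hasDerivAt_hypF hy2).comp y hsub)).add
      ((hasDerivAt_hypF hy1).mul ((hasDerivAt_mul_hypQ hy2).comp y hsub))).congr_deriv ?_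
    have := hy.1.ne'
    have : 1 - y ≠ 0 := by linarith [hy.2]
    simp only [Function.comp]
    rw [sub_sub_cancel]
    field_simp
    ring
  have hconst : ∀ y ∈ Ioo (0 : ℝ) 1, w y = w x := fun y hy =>
    isOpen_Ioo.is_const_of_deriv_eq_zero isPreconnected_Ioo
      (fun z hz => (hder z hz).differentiableAt.differentiableWithinAt)
      (fun z hz => (hder z hz).deriv) hy ⟨h0, h1⟩
  -- In the second term the singular factor `F(y)` is tamed by `1 - y`, as `hypCoeff k → 0`.
  have hlim : Tendsto w (𝓝[<] 1) (𝓝 (1 * (1 / Real.pi) * hypF (1 - 1) + 0 * hypQ (1 - 1))) := by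
    have hid : Tendsto (fun y : ℝ => y) (𝓝[<] 1) (𝓝 1) := tendsto_id.mono_left nhdsWithin_le_nhds
    have hsub : Tendsto (fun y : ℝ => 1 - y) (𝓝[<] 1) (𝓝 (1 - 1)) := hid.const_sub 1
    have hF : Tendsto (fun y => hypF (1 - y)) (𝓝[<] 1) (𝓝 (hypF (1 - 1))) :=
      (continuousAt_hypF (by simp)).tendsto.comp hsub
    have hQ : Tendsto (fun y => hypQ (1 - y)) (𝓝[<] 1) (𝓝 (hypQ (1 - 1))) :=
      (continuousAt_hypQ (by simp)).tendsto.comp hsub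
    refine (((hid.mul tendsto_hypQ_one).mul hF).add ((tendsto_one_sub_mul_tsum_mul_pow
      abs_hypCoeff_le_one tendsto_hypCoeff).mul hQ)).congr fun y => ?_
    simp only [hw, hypF]
    ring
  rw [sub_self, hypF_zero, one_mul, mul_one, zero_mul, add_zero] at hlim
  refine tendsto_nhds_unique (tendsto_const_nhds.congr' ?_) hlim
  filter_upwards [Ioo_mem_nhdsLT (show (0 : ℝ) < 1 by norm_num)] with y hy
  exact (hconst y hy).symm

theorem hypF_mul_hypQ_half : hypF (1 / 2) * hypQ (1 / 2) = 1 / Real.pi := by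
  have h := hypF_legendre (x := 1 / 2) (by norm_num) (by norm_num)
  norm_num at h ⊢
  linarith

/-! ### Landen's transformation -/

theorem hypQ_zero : hypQ 0 = 1 / 4 := by
  rw [hypQ, tsum_eq_single 0 fun k hk => by simp [hk]]
  simp

theorem one_sub_landen {t : ℝ} (h0 : 0 ≤ t) :
    1 - 4 * t / (1 + t) ^ 2 = (1 - t) ^ 2 / (1 + t) ^ 2 := by
  field_simp
  ring

theorem abs_landen_lt_one {t : ℝ} (h0 : 0 ≤ t) (h1 : t < 1) : |4 * t / (1 + t) ^ 2| < 1 := by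
  rw [abs_of_nonneg (by positivity)]
  have : 0 < (1 - t) ^ 2 / (1 + t) ^ 2 := by
    have : 0 < 1 - t := by linarith
    positivity
  linarith [one_sub_landen h0]

theorem abs_sq_lt_one {t : ℝ} (h0 : 0 ≤ t) (h1 : t < 1) : |t ^ 2| < 1 := by
  rw [abs_of_nonneg (by positivity)]
  exact pow_lt_one₀ h0 h1 two_ne_zero

theorem hasDerivAt_landen {t : ℝ} (h0 : 0 ≤ t) :
    HasDerivAt (fun y : ℝ => 4 * y / (1 + y) ^ 2) (4 * (1 - t) / (1 + t) ^ 3) t := by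
  have h : (1 + t) ^ 2 ≠ 0 := by positivity
  refine (((hasDerivAt_id' t).const_mul 4).div (((hasDerivAt_id' t).const_add 1).pow 2)
    h).congr_deriv ?_
  simp
  field_simp
  ring

theorem hasDerivAt_sq (t : ℝ) : HasDerivAt (fun y : ℝ => y ^ 2) (2 * t) t := by
  simpa using hasDerivAt_pow 2 t

/-- The functions `u t = F(4 t / (1 + t)²)` and `v t = (1 + t) F(t²)` solve the same equation
`(p u')' = q u`, where `p t = t (1 - t) / (1 + t)`. So `p (u' v - u v')` is constant, and it
vanishes at `0` because `p` does. -/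
theorem landen_wronskian {t : ℝ} (h0 : 0 ≤ t) (h1 : t < 1) :
    4 * t / (1 + t) ^ 2 * hypQ (4 * t / (1 + t) ^ 2) * ((1 + t) * hypF (t ^ 2)) =
      hypF (4 * t / (1 + t) ^ 2) *
        (t * (1 - t) / (1 + t) * hypF (t ^ 2) + 2 / (1 + t) * (t ^ 2 * hypQ (t ^ 2))) := by
  set w : ℝ → ℝ := fun t =>
    4 * t / (1 + t) ^ 2 * hypQ (4 * t / (1 + t) ^ 2) * ((1 + t) * hypF (t ^ 2)) -
      hypF (4 * t / (1 + t) ^ 2) *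
        (t * (1 - t) / (1 + t) * hypF (t ^ 2) + 2 / (1 + t) * (t ^ 2 * hypQ (t ^ 2))) with hw
  have hder : ∀ y : ℝ, 0 ≤ y → y < 1 → HasDerivAt w 0 y := by
    intro y hy0 hy1
    have hx := abs_landen_lt_one hy0 hy1
    have hs := abs_sq_lt_one hy0 hy1
    have hl := hasDerivAt_landen hy0
    have hy : 1 + y ≠ 0 := by positivity
    have hy' : 1 - y ≠ 0 := by linarith
    have hFs := HasDerivAt.comp (h := fun y : ℝ => y ^ 2) y (hasDerivAt_hypF hs) (hasDerivAt_sq y)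
    have hFx := (hasDerivAt_hypF hx).comp y hl
    have hQs := HasDerivAt.comp (h := fun y : ℝ => y ^ 2) y (hasDerivAt_mul_hypQ hs)
      (hasDerivAt_sq y)
    have hQx := (hasDerivAt_mul_hypQ hx).comp y hl
    have h1y : HasDerivAt (fun y : ℝ => 1 + y) 1 y := (hasDerivAt_id' y).const_add 1
    have hp := ((hasDerivAt_id' y).mul ((hasDerivAt_id' y).const_sub 1)).div h1y hy
    have h2 := (hasDerivAt_const y (2 : ℝ)).div h1y hy
    refine ((hQx.mul (h1y.mul hFs)).sub (hFx.mul ((hp.mul hFs).add (h2.mul hQs)))).congr_deriv ?_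
    simp only [Function.comp, Pi.mul_apply, Pi.add_apply, Pi.div_apply]
    rw [one_sub_landen hy0, show 1 - y ^ 2 = (1 - y) * (1 + y) by ring]
    generalize hypF (y ^ 2) = a
    generalize hypQ (y ^ 2) = b
    generalize hypF (4 * y / (1 + y) ^ 2) = c
    generalize hypQ (4 * y / (1 + y) ^ 2) = d
    field_simp
    ring
  have hw0 : w 0 = 0 := by simp [hw]
  have hwt : w t = w 0 := constant_of_has_deriv_right_zero
    (fun y hy => (hder y hy.1 (hy.2.trans_lt h1)).continuousAt.continuousWithinAt)
    (fun y hy => (hder y hy.1 (hy.2.trans h1)).hasDerivWithinAt) t ⟨h0, le_rfl⟩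
  rw [hw0] at hwt
  exact sub_eq_zero.1 hwt

/-- **Landen's transformation** of the complete elliptic integral of the first kind. -/
theorem hypF_landen {t : ℝ} (h0 : 0 ≤ t) (h1 : t < 1) :
    hypF (4 * t / (1 + t) ^ 2) = (1 + t) * hypF (t ^ 2) := by
  have hpos : ∀ y : ℝ, 0 ≤ y → y < 1 → (1 + y) * hypF (y ^ 2) ≠ 0 := fun y hy0 hy1 =>
    (mul_pos (by positivity) (hypF_pos (by positivity) (abs_lt.1 (abs_sq_lt_one hy0 hy1)).2)).ne'
  set g : ℝ → ℝ := fun t => hypF (4 * t / (1 + t) ^ 2) / ((1 + t) * hypF (t ^ 2)) with hg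
  have hder : ∀ y : ℝ, 0 ≤ y → y < 1 → HasDerivAt g 0 y := by
    intro y hy0 hy1
    have hx := abs_landen_lt_one hy0 hy1
    have hs := abs_sq_lt_one hy0 hy1
    have hy : 1 + y ≠ 0 := by positivity
    have hy' : 1 - y ≠ 0 := by linarith
    refine (((hasDerivAt_hypF hx).comp y (hasDerivAt_landen hy0)).div
      (((hasDerivAt_id' y).const_add 1).mul (HasDerivAt.comp (h := fun y : ℝ => y ^ 2) y
        (hasDerivAt_hypF hs) (hasDerivAt_sq y)))
      (hpos y hy0 hy1)).congr_deriv ?_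
    rw [div_eq_zero_iff]
    left
    simp only [Function.comp, Pi.mul_apply]
    -- At `y = 0` the Wronskian identity is void, but both derivatives are `1` there.
    rcases hy0.eq_or_lt with rfl | hy0'
    · norm_num [hypF_zero, hypQ_zero]
    have hW := landen_wronskian hy0 hy1
    rw [one_sub_landen hy0, show 1 - y ^ 2 = (1 - y) * (1 + y) by ring]
    generalize hypF (y ^ 2) = a at *
    generalize hypQ (y ^ 2) = b at *
    generalize hypF (4 * y / (1 + y) ^ 2) = c at *
    generalize hypQ (4 * y / (1 + y) ^ 2) = d at *
    field_simp at hW ⊢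
    linarith
  have hgt : g t = g 0 := constant_of_has_deriv_right_zero
    (fun y hy => (hder y hy.1 (hy.2.trans_lt h1)).continuousAt.continuousWithinAt)
    (fun y hy => (hder y hy.1 (hy.2.trans h1)).hasDerivWithinAt) t ⟨h0, le_rfl⟩
  have hg0 : g 0 = 1 := by simp [hg, hypF_zero]
  rw [hg0] at hgt
  exact eq_of_div_eq_one hgt

/-- The derivative of Landen's transformation. -/
theorem hypQ_landen {t : ℝ} (h0 : 0 < t) (h1 : t < 1) :
    hypQ (4 * t / (1 + t) ^ 2) =
      (1 + t) / 4 * ((1 - t) * hypF (t ^ 2) + 2 * t * hypQ (t ^ 2)) := by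
  have hW := landen_wronskian h0.le h1
  have hF := hypF_pos (x := t ^ 2) (by positivity) (abs_lt.1 (abs_sq_lt_one h0.le h1)).2
  rw [hypF_landen h0.le h1] at hW
  field_simp at hW ⊢
  linarith

/-- The quantity `F(x) (a F(x) + b x F'(x))`, with `F'(x)` written as `hypQ x / (1 - x)`. -/
noncomputable def hypInvariant (a b x : ℝ) : ℝ :=
  hypF x * (a * hypF x + b * (x * hypQ x / (1 - x)))

/-- One step of the quadratic iteration leaves `hypInvariant` unchanged. -/
theorem hypInvariant_landen (a b : ℝ) {t : ℝ} (h0 : 0 < t) (h1 : t < 1) :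
    hypInvariant (a * (1 + t) ^ 2 + 2 * b * ((1 + t) ^ 3 / (1 - t)) * t / (2 * (1 + t)))
      (2 * b * ((1 + t) ^ 3 / (1 - t))) (t ^ 2) = hypInvariant a b (4 * t / (1 + t) ^ 2) := by
  have hy' : 1 - t ≠ 0 := by linarith
  rw [hypInvariant, hypInvariant, hypF_landen h0.le h1, hypQ_landen h0 h1, one_sub_landen h0.le,
    show 1 - t ^ 2 = (1 - t) * (1 + t) by ring]
  field_simp
  ring

/-! ### The iterations -/

theorem dSeq_pos_lt_one {d₀ : ℝ} (h0 : 0 < d₀) (h1 : d₀ < 1) (n : ℕ) :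
    0 < dSeq d₀ n ∧ dSeq d₀ n < 1 := by
  induction n with
  | zero => exact ⟨h0, h1⟩
  | succ n ih =>
    have hlt : √(1 - dSeq d₀ n ^ 2) < 1 := by
      rw [Real.sqrt_lt' one_pos]
      nlinarith
    have hpos : 0 < √(1 - dSeq d₀ n ^ 2) := Real.sqrt_pos.2 (by nlinarith)
    rw [dSeq]
    exact ⟨div_pos (by linarith) (by linarith), (div_lt_one (by linarith)).2 (by linarith)⟩

/-- The complementary modulus `√(1 - d n ^ 2)` in terms of `d (n + 1)`. -/
theorem sqrt_one_sub_dSeq_sq (d₀ : ℝ) (n : ℕ) :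
    √(1 - dSeq d₀ n ^ 2) = (1 - dSeq d₀ (n + 1)) / (1 + dSeq d₀ (n + 1)) := by
  have h := Real.sqrt_nonneg (1 - dSeq d₀ n ^ 2)
  rw [dSeq]
  field_simp
  ring

/-- The recursion for `d`, solved for `d n`: this is the argument of `F` in `hypF_landen` at
`t = d (n + 1)`. -/
theorem dSeq_sq {d₀ : ℝ} (h0 : 0 < d₀) (h1 : d₀ < 1) (n : ℕ) :
    dSeq d₀ n ^ 2 = 4 * dSeq d₀ (n + 1) / (1 + dSeq d₀ (n + 1)) ^ 2 := by
  obtain ⟨hp, hl⟩ := dSeq_pos_lt_one h0 h1 n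
  have h := Real.sq_sqrt (show 0 ≤ 1 - dSeq d₀ n ^ 2 by nlinarith)
  rw [sqrt_one_sub_dSeq_sq, div_pow, ← one_sub_landen (dSeq_pos_lt_one h0 h1 (n + 1)).1.le] at h
  linarith

theorem dSeq_succ_le {d₀ : ℝ} (h0 : 0 < d₀) (h1 : d₀ < 1) (n : ℕ) :
    dSeq d₀ (n + 1) ≤ dSeq d₀ n ^ 2 := by
  obtain ⟨hp, hl⟩ := dSeq_pos_lt_one h0 h1 (n + 1)
  rw [dSeq_sq h0 h1, le_div_iff₀ (by positivity), mul_comm (4 : ℝ)]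
  gcongr
  nlinarith

theorem dSeq_le_pow {d₀ : ℝ} (h0 : 0 < d₀) (h1 : d₀ < 1) (n : ℕ) : dSeq d₀ n ≤ d₀ ^ (n + 1) := by
  induction n with
  | zero => simp [dSeq]
  | succ n ih =>
    have hp := (dSeq_pos_lt_one h0 h1 n).1
    calc dSeq d₀ (n + 1) ≤ dSeq d₀ n * dSeq d₀ n := by
          simpa [sq] using dSeq_succ_le h0 h1 n
      _ ≤ d₀ ^ (n + 1) * d₀ := by
          gcongr
          exact ih.trans (pow_le_of_le_one h0.le h1.le (Nat.succ_ne_zero n))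
      _ = d₀ ^ (n + 1 + 1) := (pow_succ _ _).symm

theorem tendsto_dSeq {d₀ : ℝ} (h0 : 0 < d₀) (h1 : d₀ < 1) : Tendsto (dSeq d₀) atTop (𝓝 0) :=
  squeeze_zero (fun n => (dSeq_pos_lt_one h0 h1 n).1.le) (dSeq_le_pow h0 h1)
    ((tendsto_pow_atTop_nhds_zero_of_lt_one h0.le h1).comp (tendsto_add_atTop_nat 1))

theorem tendsto_two_pow_mul_dSeq_sq {d₀ : ℝ} (h0 : 0 < d₀) (h1 : d₀ < 1 / 2) :
    Tendsto (fun n => 2 ^ n * dSeq d₀ n ^ 2) atTop (𝓝 0) := by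
  have h1' : d₀ < 1 := by linarith
  refine squeeze_zero (fun n => by positivity) (fun n => ?_)
    (tendsto_pow_atTop_nhds_zero_of_lt_one (r := 2 * d₀) (by positivity) (by linarith))
  obtain ⟨hp, hl⟩ := dSeq_pos_lt_one h0 h1' n
  have h2 : dSeq d₀ n ≤ d₀ ^ n :=
    (dSeq_le_pow h0 h1' n).trans (pow_le_pow_of_le_one h0.le h1'.le (Nat.le_succ n))
  rw [mul_pow]
  gcongr
  nlinarith

theorem bSeq_eq {d₀ b₀ c₀ : ℝ} (h0 : 0 < d₀) (h1 : d₀ < 1) (hc : c₀ = b₀ / (1 - d₀ ^ 2)) (n : ℕ) :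
    bSeq d₀ b₀ n = c₀ * 2 ^ n * (1 - dSeq d₀ n ^ 2) := by
  induction n with
  | zero =>
    have : 1 - d₀ ^ 2 ≠ 0 := by nlinarith
    rw [hc, bSeq, dSeq]
    field_simp
  | succ n ih =>
    obtain ⟨hp, hl⟩ := dSeq_pos_lt_one h0 h1 (n + 1)
    have : 1 - dSeq d₀ (n + 1) ≠ 0 := by linarith
    rw [bSeq, ih, dSeq_sq h0 h1, one_sub_landen hp.le]
    field_simp
    ring

theorem hypInvariant_aSeq_bSeq {d₀ : ℝ} (h0 : 0 < d₀) (h1 : d₀ < 1) (a₀ b₀ : ℝ) (n : ℕ) :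
    hypInvariant (aSeq d₀ b₀ a₀ n) (bSeq d₀ b₀ n) (dSeq d₀ n ^ 2) =
      hypInvariant a₀ b₀ (d₀ ^ 2) := by
  induction n with
  | zero => rfl
  | succ n ih =>
    obtain ⟨hp, hl⟩ := dSeq_pos_lt_one h0 h1 (n + 1)
    rw [← ih, dSeq_sq h0 h1 n, ← hypInvariant_landen _ _ hp hl]
    rfl

/-- As `d n → 0` so fast that `b n * d n ^ 2 → 0`, only the term `a n` of the invariant survives. -/
theorem tendsto_aSeq {d₀ : ℝ} (h0 : 0 < d₀) (h1 : d₀ < 1 / 2) (a₀ b₀ : ℝ) :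
    Tendsto (aSeq d₀ b₀ a₀) atTop (𝓝 (hypInvariant a₀ b₀ (d₀ ^ 2))) := by
  have h1' : d₀ < 1 := by linarith
  have hd := (tendsto_dSeq h0 h1').pow 2
  rw [zero_pow two_ne_zero] at hd
  have hF : Tendsto (fun n => hypF (dSeq d₀ n ^ 2)) atTop (𝓝 1) := by
    rw [← hypF_zero]
    exact (continuousAt_hypF (by simp)).tendsto.comp hd
  have hQ : Tendsto (fun n => hypQ (dSeq d₀ n ^ 2)) atTop (𝓝 (1 / 4)) := by
    rw [← hypQ_zero]
    exact (continuousAt_hypQ (by simp)).tendsto.comp hd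
  have hb : Tendsto (fun n => b₀ / (1 - d₀ ^ 2) * (2 ^ n * dSeq d₀ n ^ 2) *
      hypQ (dSeq d₀ n ^ 2)) atTop (𝓝 (b₀ / (1 - d₀ ^ 2) * 0 * (1 / 4))) :=
    ((tendsto_two_pow_mul_dSeq_sq h0 h1).const_mul _).mul hQ
  -- The invariant at step `n`, solved for `a n`.
  have h := (((tendsto_const_nhds (x := hypInvariant a₀ b₀ (d₀ ^ 2))).div hF one_ne_zero).sub
    hb).div hF one_ne_zero
  simp only [mul_zero, zero_mul, sub_zero, div_one] at h
  refine h.congr fun n => ?_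
  obtain ⟨hp, hl⟩ := dSeq_pos_lt_one h0 h1' n
  have hFn : hypF (dSeq d₀ n ^ 2) ≠ 0 := (hypF_pos (by positivity) (by nlinarith)).ne'
  have hdn : 1 - dSeq d₀ n ^ 2 ≠ 0 := by nlinarith
  have hd0 : 1 - d₀ ^ 2 ≠ 0 := by nlinarith
  simp only [Pi.div_apply]
  rw [← hypInvariant_aSeq_bSeq h0 h1' a₀ b₀ n, hypInvariant, bSeq_eq h0 h1' rfl]
  field_simp
  ring

theorem aSimpleSeq_eq_aSeq {d₀ b₀ c₀ : ℝ} (h0 : 0 < d₀) (h1 : d₀ < 1)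
    (hc : c₀ = b₀ / (1 - d₀ ^ 2)) (a₀ : ℝ) (n : ℕ) :
    aSimpleSeq d₀ a₀ c₀ n = aSeq d₀ b₀ a₀ n := by
  induction n with
  | zero => rfl
  | succ n ih =>
    obtain ⟨hp, hl⟩ := dSeq_pos_lt_one h0 h1 (n + 1)
    rw [aSimpleSeq, aSeq, ih, bSeq_eq h0 h1 hc]
    field_simp
    ring

theorem rSeq_eq {d₀ : ℝ} (h0 : 0 < d₀) (h1 : d₀ < 1) (a₀ c₀ : ℝ) (n : ℕ) :
    rSeq d₀ (a₀ + c₀ * d₀ ^ 2 / 2) c₀ n =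
      aSimpleSeq d₀ a₀ c₀ n + c₀ / 2 * (2 ^ n * dSeq d₀ n ^ 2) := by
  induction n with
  | zero => simp only [rSeq, aSimpleSeq, dSeq]; ring
  | succ n ih =>
    obtain ⟨hp, hl⟩ := dSeq_pos_lt_one h0 h1 (n + 1)
    rw [rSeq, aSimpleSeq, ih, dSeq_sq h0 h1]
    field_simp
    ring

/-- In terms of `s = √(d (n + 1))`, the modulus `d n` is rational. This is what makes two quadratic
steps into one quartic step. -/
theorem dSeq_eq_of_sq_eq {d₀ s : ℝ} (h0 : 0 < d₀) (h1 : d₀ < 1) (hs : 0 ≤ s) {n : ℕ}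
    (h : s ^ 2 = dSeq d₀ (n + 1)) : dSeq d₀ n = 2 * s / (1 + s ^ 2) := by
  have hp := (dSeq_pos_lt_one h0 h1 n).1
  rw [← sq_eq_sq₀ hp.le (by positivity), dSeq_sq h0 h1, ← h, div_pow]
  ring

theorem sSeq_sq {d₀ : ℝ} (h0 : 0 < d₀) (h1 : d₀ < 1) (n : ℕ) :
    0 ≤ sSeq √d₀ n ∧ sSeq √d₀ n ^ 2 = dSeq d₀ (2 * n) := by
  induction n with
  | zero => exact ⟨Real.sqrt_nonneg _, Real.sq_sqrt h0.le⟩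
  | succ n ih =>
    obtain ⟨hp, hl⟩ := dSeq_pos_lt_one h0 h1 (2 * n)
    obtain ⟨hp1, hl1⟩ := dSeq_pos_lt_one h0 h1 (2 * n + 1)
    obtain ⟨hp2, hl2⟩ := dSeq_pos_lt_one h0 h1 (2 * n + 2)
    have hs4 : sSeq √d₀ n ^ 4 = dSeq d₀ (2 * n) ^ 2 := by rw [← ih.2]; ring
    set q := (1 - sSeq √d₀ n ^ 4) ^ (1 / 4 : ℝ) with hq
    have hbase : 0 ≤ 1 - sSeq √d₀ n ^ 4 := by rw [hs4]; nlinarith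
    have hq0 : 0 ≤ q := Real.rpow_nonneg hbase _
    have hq1 : q ≤ 1 := Real.rpow_le_one hbase (by rw [hs4]; nlinarith) (by norm_num)
    -- `q` is the square root of the complementary modulus of `d (2 n)`, and
    -- `√(1 - d (2 n + 1) ^ 2)` is rational in `q`.
    have hq2 : q ^ 2 = √(1 - dSeq d₀ (2 * n) ^ 2) := by
      rw [hq, hs4, Real.sqrt_eq_rpow, ← Real.rpow_natCast,
        ← Real.rpow_mul (by rw [← hs4]; exact hbase)]
      norm_num
    have hd1 : dSeq d₀ (2 * n + 1) = (1 - q ^ 2) / (1 + q ^ 2) := by rw [dSeq, hq2]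
    have hk : √(1 - dSeq d₀ (2 * n + 1) ^ 2) = 2 * q / (1 + q ^ 2) := by
      rw [Real.sqrt_eq_iff_mul_self_eq (by nlinarith) (by positivity), hd1]
      field_simp
      ring
    rw [sSeq, ← hq]
    refine ⟨div_nonneg (by linarith) (by linarith), ?_⟩
    rw [show 2 * (n + 1) = 2 * n + 1 + 1 by ring, dSeq, hk]
    field_simp
    ring

theorem tSeq_eq_rSeq {d₀ : ℝ} (h0 : 0 < d₀) (h1 : d₀ < 1) (r₀ c₀ : ℝ) (n : ℕ) :
    tSeq √d₀ r₀ c₀ n = rSeq d₀ r₀ c₀ (2 * n) := by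
  induction n with
  | zero => rfl
  | succ n ih =>
    obtain ⟨hs, h2⟩ := sSeq_sq h0 h1 (n + 1)
    have hd1 := dSeq_eq_of_sq_eq h0 h1 hs (n := 2 * n + 1) h2
    rw [tSeq, ih, show 2 * (n + 1) = 2 * n + 1 + 1 by ring, rSeq, rSeq, hd1,
      show dSeq d₀ (2 * n + 1 + 1) = sSeq √d₀ (n + 1) ^ 2 from h2.symm]
    field_simp
    ring

/-! ### The invariant at the modulus `3 - 2 √2` -/

/-- The modulus `3 - 2 √2` is one Landen step away from the self-complementary modulus `1 / √2`,
where Legendre's relation has the two equal terms of `hypF_mul_hypQ_half`. -/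
theorem hypInvariant_three_sub_two_sqrt_two :
    hypInvariant (4 * (5 * √2 - 7)) (16 * (3 * √2 - 4)) ((3 - 2 * √2) ^ 2) = 1 / Real.pi := by
  have h2 : √2 ^ 2 = 2 := Real.sq_sqrt (by norm_num)
  have hlo : 1.4 < √2 := Real.lt_sqrt_of_sq_lt (by norm_num)
  have hhi : √2 < 1.5 := (Real.sqrt_lt' (by norm_num)).2 (by norm_num)
  have hne : 1 - (3 - 2 * √2) ≠ 0 := by intro h; linarith
  have hne' : 1 + (3 - 2 * √2) ≠ 0 := by intro h; linarith
  have hx : 4 * (3 - 2 * √2) / (1 + (3 - 2 * √2)) ^ 2 = 1 / 2 := by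
    rw [div_eq_div_iff (pow_ne_zero 2 hne') two_ne_zero]
    linear_combination -4 * h2
  have hb : 2 * 1 * ((1 + (3 - 2 * √2)) ^ 3 / (1 - (3 - 2 * √2))) = 16 * (3 * √2 - 4) := by
    rw [mul_div_assoc', div_eq_iff hne]
    linear_combination (-16 * √2) * h2
  have ha : 16 * (3 * √2 - 4) * (3 - 2 * √2) / (2 * (1 + (3 - 2 * √2))) =
      4 * (5 * √2 - 7) := by
    rw [div_eq_iff (mul_ne_zero two_ne_zero hne')]
    linear_combination (-16) * h2
  have h := hypInvariant_landen 0 1 (t := 3 - 2 * √2) (by linarith) (by linarith)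
  rw [hx, hb, zero_mul, zero_add, ha] at h
  rw [h, hypInvariant, ← hypF_mul_hypQ_half]
  norm_num

theorem summable_hypCoeff_mul_pow_mul {x : ℝ} (hx : |x| < 1) (a b : ℝ) :
    Summable fun k : ℕ => hypCoeff k * x ^ k * (b * k + a) :=
  (((summable_natCast_mul_pow_of_abs_le_one abs_hypCoeff_le_one hx).mul_left b).add
    ((summable_mul_pow_of_abs_le_one abs_hypCoeff_le_one hx).mul_left a)).congr fun k => by ring

theorem hypF_mul_tsum_eq_hypInvariant {x : ℝ} (hx : |x| < 1) (a b : ℝ) :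
    hypF x * ∑' k : ℕ, hypCoeff k * x ^ k * (b * k + a) = hypInvariant a b x := by
  rw [hypInvariant, ← tsum_natCast_mul_hypCoeff_mul_pow hx]
  congr 1
  conv_rhs => rw [hypF, ← tsum_mul_left, ← tsum_mul_left]
  rw [← ((summable_mul_pow_of_abs_le_one abs_hypCoeff_le_one hx).mul_left a).tsum_add
    ((summable_natCast_mul_pow_of_abs_le_one abs_hypCoeff_le_one hx).mul_left b)]
  exact tsum_congr fun k => by ring

theorem mainTheorem4 (d₀ b₀ a₀ c₀ r₀ s₀ t₀ : ℝ)
    (hd : d₀ = 3 - 2 * √2)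
    (hb : b₀ = 16 * (3 * √2 - 4))
    (ha : a₀ = 4 * (5 * √2 - 7))
    (hc : c₀ = b₀ / (1 - d₀ ^ 2))
    (hr : r₀ = a₀ + c₀ * d₀ ^ 2 / 2)
    (hs : s₀ = √d₀)
    (ht : t₀ = r₀) :
    -- the identity, with convergence of both series
    (Summable (fun k : ℕ => hypCoeff k * (3 - 2 * √2) ^ (2 * k)) ∧
      Summable (fun k : ℕ => hypCoeff k * (3 - 2 * √2) ^ (2 * k) *
        (16 * (3 * √2 - 4) * (k : ℝ) + 4 * (5 * √2 - 7))) ∧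
      (∑' k : ℕ, hypCoeff k * (3 - 2 * √2) ^ (2 * k)) *
        (∑' k : ℕ, hypCoeff k * (3 - 2 * √2) ^ (2 * k) *
          (16 * (3 * √2 - 4) * (k : ℝ) + 4 * (5 * √2 - 7))) = 1 / Real.pi) ∧
    -- the initial values
    (d₀ = s₀ ^ 2 ∧ b₀ = 48 * √2 - 64 ∧ a₀ = 20 * √2 - 28 ∧ c₀ = 4 ∧
      r₀ = 6 - 4 * √2 ∧ t₀ = 6 - 4 * √2) ∧
    -- with these initial values the iterations tend to `1 / π`
    (Filter.Tendsto (aSeq d₀ b₀ a₀) Filter.atTop (nhds (1 / Real.pi)) ∧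
      Filter.Tendsto (aSimpleSeq d₀ a₀ c₀) Filter.atTop (nhds (1 / Real.pi)) ∧
      Filter.Tendsto (rSeq d₀ r₀ c₀) Filter.atTop (nhds (1 / Real.pi)) ∧
      Filter.Tendsto (tSeq s₀ t₀ c₀) Filter.atTop (nhds (1 / Real.pi))) := by
  have h2 : √2 ^ 2 = 2 := Real.sq_sqrt (by norm_num)
  have hlo : 1.4 < √2 := Real.lt_sqrt_of_sq_lt (by norm_num)
  have hhi : √2 < 1.5 := (Real.sqrt_lt' (by norm_num)).2 (by norm_num)
  have h0 : 0 < d₀ := by rw [hd]; linarith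
  have h1 : d₀ < 1 / 2 := by rw [hd]; linarith
  have h1' : d₀ < 1 := by linarith
  have hx : |(3 - 2 * √2) ^ 2| < 1 := by rw [← hd]; exact abs_sq_lt_one h0.le h1'
  have hc4 : c₀ = 4 := by
    rw [hc, div_eq_iff (by nlinarith), hb, hd]
    linear_combination (16 : ℝ) * h2
  have hr6 : r₀ = 6 - 4 * √2 := by
    rw [hr, hc4, ha, hd]
    linear_combination (8 : ℝ) * h2
  have hlim : Tendsto (aSeq d₀ b₀ a₀) atTop (𝓝 (1 / Real.pi)) := by
    rw [← hypInvariant_three_sub_two_sqrt_two, ← hd, ← ha, ← hb]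
    exact tendsto_aSeq h0 h1 a₀ b₀
  have hsimple : Tendsto (aSimpleSeq d₀ a₀ c₀) atTop (𝓝 (1 / Real.pi)) :=
    hlim.congr fun n => (aSimpleSeq_eq_aSeq h0 h1' hc a₀ n).symm
  have hrlim : Tendsto (rSeq d₀ r₀ c₀) atTop (𝓝 (1 / Real.pi)) := by
    have h := hsimple.add ((tendsto_two_pow_mul_dSeq_sq h0 h1).const_mul (c₀ / 2))
    rw [mul_zero, add_zero] at h
    rw [hr]
    exact h.congr fun n => (rSeq_eq h0 h1' a₀ c₀ n).symm
  have htlim : Tendsto (tSeq s₀ t₀ c₀) atTop (𝓝 (1 / Real.pi)) := by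
    rw [hs, ht]
    exact (hrlim.comp (tendsto_id.const_mul_atTop' two_pos)).congr
      fun n => (tSeq_eq_rSeq h0 h1' r₀ c₀ n).symm
  simp only [pow_mul]
  refine ⟨⟨summable_mul_pow_of_abs_le_one abs_hypCoeff_le_one hx,
    summable_hypCoeff_mul_pow_mul hx _ _, ?_⟩,
    ⟨by rw [hs, Real.sq_sqrt h0.le], by rw [hb]; ring, by rw [ha]; ring, hc4, hr6, ht.trans hr6⟩,
    hlim, hsimple, hrlim, htlim⟩
  rw [← hypInvariant_three_sub_two_sqrt_two]
  exact hypF_mul_tsum_eq_hypInvariant hx _ _
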